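/- Let $\mathbb{T}=\mathbb{R}\cup\{\infty\}$ be the tropical semiring with operations $\min$ and $+$. For a finite set $E$ let $\mathbb{TP}(E)=(\mathbb{T}^E\setminus\{(\infty,\dots,\infty)\})/\mathbb{R}(1,\dots,1)$ be the tropical projective space with coordinates indexed by $E$. A valuated matroid $V$ of rank $d$ on $E$ is a point of $\mathbb{TP}\big(\binom{E}{d}\big)$ satisfying the tropical Plücker relations: for all $A\in\binom{E}{d-1}$ and $C\in\binom{E}{d+1}$, the minimum of $V_{A\cup\{j\}}+V_{C\setminus\{j\}}$ over $j\in C\setminus A$ is attained at more than one $j$. The sets $B$ with $V_B<\infty$ are the bases of its underlying matroid $\underline V$. A presentation of $V$ is a multiset $\mathcal{A}$ of $d$ points of $\mathbb{TP}(E)$ such that, for a matrix $A\in\mathbb{T}^{d\times E}$ whose rows are coordinate vectors of the elements of $\mathcal{A}$, the vector $\pi(A)$ of tropical maximal minors $$\pi(A)_B=\min\Big\{\sum_{i=1}^d A_{i,j_i} : \{j_1,\dots,j_d\}=B\Big\}\qquad \Big(B\in\tbinom{E}{d}\Big)$$ is not identically $\infty$ and equals $V$ in $\mathbb{TP}\big(\binom{E}{d}\big)$.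 The dual $V^*$ is the valuated matroid of rank $|E|-d$ with $V^*_B=V_{E\setminus B}$. For $J\subseteq E$ and a basis $B_c$ of $\underline V/J$, the restriction $V|J$ is the valuated matroid on $J$ of rank $d-|B_c|$ with $(V|J)_B=V_{B\cup B_c}$ (as a point of tropical projective space it does not depend on $B_c$). The contraction is $V/J=(V^*|(E\setminus J))^*$, a valuated matroid on $E\setminus J$. **Proposition.** Let $V$ be a valuated matroid of rank $d$ on a finite set $E$, let $\mathcal{A}$ be a presentation of $V$, and let $F\subseteq E$ be a cyclic flat of $\underline V$ (that is, $F$ is a flat of $\underline V$ and $E\setminus F$ is a flat of the dual matroid $\underline V^*$) of rank $k$ in $\underline V$. Then exactly $d-k$ points of $\mathcal{A}$, counted with multiplicity, have all their coordinates indexed by $F$ equal to $\infty$, and the multiset of the projections of these points to the coordinates indexed by $E\setminus F$ is a presentation of the contraction $V/F$. -/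

import Mathlib

/-!
# Tropical projective space, valuated matroids and the tropical Stiefel map

The tropical numbers `ℝ ∪ {∞}` are `WithTop ℝ`, with `min` as tropical addition and `+` as tropical
multiplication. The ground set is an arbitrary finite type `E`; `E = Fin n` is the set `[n]`.
-/

/-- Affine coordinate vectors: vectors of tropical numbers other than `(∞, …, ∞)`. -/
def TropVec (ι : Type*) : Type _ := {x : ι → WithTop ℝ // ∃ i, x i ≠ ⊤}

/-- Two vectors agree up to the addition of a real multiple of `(1, …, 1)`. -/
instance TropVec.setoid (ι : Type*) : Setoid (TropVec ι) where
  r x y := ∃ c : ℝ, ∀ i, y.1 i = x.1 i + (c : WithTop ℝ)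
  iseqv := by
    refine ⟨fun x => ⟨0, by simp⟩, ?_, ?_⟩
    · rintro x y ⟨c, h⟩
      refine ⟨-c, fun i => ?_⟩
      rw [h i, add_assoc, ← WithTop.coe_add, add_neg_cancel, WithTop.coe_zero, add_zero]
    · rintro x y z ⟨c, h⟩ ⟨d, h'⟩
      exact ⟨c + d, fun i => by rw [h' i, h i, WithTop.coe_add, add_assoc]⟩

/-- Tropical projective space with coordinates indexed by `ι`. -/
def TropProj (ι : Type*) : Type _ := Quotient (TropVec.setoid ι)

namespace TropProj

/-- The point of tropical projective space with the given affine coordinates. -/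
def mk {ι : Type*} (x : TropVec ι) : TropProj ι := Quotient.mk _ x

/-- The `i`-th coordinate of `x` is `∞`. -/
def IsInf {ι : Type*} (x : TropProj ι) (i : ι) : Prop :=
  Quotient.lift (fun y : TropVec ι => y.1 i = ⊤)
    (by
      rintro y z ⟨c, h⟩
      simp [h i]) x

theorem exists_not_isInf {ι : Type*} (x : TropProj ι) : ∃ i, ¬ x.IsInf i := by
  obtain ⟨y, rfl⟩ := Quotient.exists_rep x
  exact y.2

/-- Pulling back coordinates along a map `f` of index sets: the coordinate of `x.comap f h` at `k` is
the coordinate of `x` at `f k`. It is defined at the points where the outcome is not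
`(∞, …, ∞)`. -/
def comap {ι κ : Type*} (f : κ → ι) (x : TropProj ι) : (∃ k, ¬ x.IsInf (f k)) → TropProj κ :=
  Quotient.hrecOn x (motive := fun x => (∃ k, ¬ IsInf x (f k)) → TropProj κ)
    (fun y h => mk ⟨fun k => y.1 (f k), h⟩)
    (by
      rintro y z ⟨c, h⟩
      refine Function.hfunext ?_ ?_
      · exact congrArg (fun w : TropProj ι => ∃ k, ¬ w.IsInf (f k))
          (Quotient.sound ⟨c, h⟩ : mk y = mk z)
      · intro h₁ h₂ _
        exact heq_of_eq (Quotient.sound ⟨c, fun k => h (f k)⟩))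

/-- All coordinates of `x` indexed by `F` are `∞`. -/
def IsInfOn {ι : Type*} (x : TropProj ι) (F : Finset ι) : Prop := ∀ i ∈ F, x.IsInf i

/-- The projection of a point to the coordinates indexed by `S`, defined at the points that have a
finite coordinate there. -/
def proj {ι : Type*} (S : Finset ι) (x : TropProj ι) (h : ∃ i ∈ S, ¬ x.IsInf i) : TropProj S :=
  x.comap (Subtype.val : S → ι) (by
    obtain ⟨i, hi, hx⟩ := h
    exact ⟨⟨i, hi⟩, hx⟩)

/-- A point whose coordinates in `F` are all `∞` has a finite coordinate outside `F`. -/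
theorem exists_compl_of_isInfOn {ι : Type*} [Fintype ι] [DecidableEq ι] {F : Finset ι}
    {x : TropProj ι} (h : x.IsInfOn F) : ∃ i ∈ Fᶜ, ¬ x.IsInf i := by
  obtain ⟨i, hi⟩ := x.exists_not_isInf
  exact ⟨i, Finset.mem_compl.2 fun hF => hi (h i hF), hi⟩

end TropProj

/-- The minimum of `f` on `s` is attained at more than one element of `s`. -/
def MinAttainedTwice {ι : Type*} (s : Finset ι) (f : ι → WithTop ℝ) : Prop :=
  ∃ i ∈ s, ∃ j ∈ s, i ≠ j ∧ (∀ k ∈ s, f i ≤ f k) ∧ ∀ k ∈ s, f j ≤ f k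

section Plucker

variable {E : Type*}

/-- The Plücker coordinate of `p` at a set `B` with `d` elements. Sets of other sizes get the value
`∞`; they do not occur in the Plücker relations below. -/
def pluckerCoord {d : ℕ} (p : {B : Finset E // B.card = d} → WithTop ℝ) (B : Finset E) :
    WithTop ℝ :=
  if h : B.card = d then p ⟨B, h⟩ else ⊤

theorem pluckerCoord_add {d : ℕ} {p q : {B : Finset E // B.card = d} → WithTop ℝ} {c : ℝ}
    (h : ∀ B, q B = p B + (c : WithTop ℝ)) (B : Finset E) :
    pluckerCoord q B = pluckerCoord p B + (c : WithTop ℝ) := by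
  unfold pluckerCoord
  split_ifs
  · exact h _
  · simp

variable [DecidableEq E]

/-- The tropical Plücker relations. -/
def PluckerRel {d : ℕ} (p : {B : Finset E // B.card = d} → WithTop ℝ) : Prop :=
  ∀ A C : Finset E, A.card + 1 = d → C.card = d + 1 →
    MinAttainedTwice (C \ A) fun j => pluckerCoord p (insert j A) + pluckerCoord p (C.erase j)

theorem PluckerRel.add {d : ℕ} {p q : {B : Finset E // B.card = d} → WithTop ℝ} {c : ℝ}
    (h : ∀ B, q B = p B + (c : WithTop ℝ)) (hp : PluckerRel p) : PluckerRel q := by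
  intro A C hA hC
  obtain ⟨i, hi, j, hj, hij, h₁, h₂⟩ := hp A C hA hC
  have key : ∀ k, pluckerCoord q (insert k A) + pluckerCoord q (C.erase k)
      = pluckerCoord p (insert k A) + pluckerCoord p (C.erase k)
        + ((c : WithTop ℝ) + (c : WithTop ℝ)) := by
    intro k
    rw [pluckerCoord_add h, pluckerCoord_add h, add_add_add_comm]
  refine ⟨i, hi, j, hj, hij, fun k hk => ?_, fun k hk => ?_⟩ <;> simp only [key]
  · exact add_le_add_left (h₁ k hk) _
  · exact add_le_add_left (h₂ k hk) _

/-- The tropical Plücker relations for a point of tropical projective space. -/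
def TropProj.IsPlucker {d : ℕ} (x : TropProj {B : Finset E // B.card = d}) : Prop :=
  Quotient.lift (fun p : TropVec {B : Finset E // B.card = d} => PluckerRel p.1)
    (by
      rintro p q ⟨c, h⟩
      refine propext ⟨PluckerRel.add h, PluckerRel.add (c := -c) fun B => ?_⟩
      rw [h B, add_assoc, ← WithTop.coe_add, add_neg_cancel, WithTop.coe_zero, add_zero]) x

theorem TropProj.IsPlucker.comap {E' : Type*} [DecidableEq E'] {d d' : ℕ}
    {x : TropProj {B : Finset E // B.card = d}} (hx : x.IsPlucker)
    (f : {B : Finset E' // B.card = d'} → {B : Finset E // B.card = d})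
    (h : ∃ B, ¬ x.IsInf (f B))
    (hf : ∀ p : {B : Finset E // B.card = d} → WithTop ℝ, PluckerRel p →
      PluckerRel fun B => p (f B)) : (x.comap f h).IsPlucker := by
  obtain ⟨p, rfl⟩ := Quotient.exists_rep x
  exact hf p.1 hx

end Plucker

/-- A valuated matroid on the ground set `E`: a point of the tropical projective space with
coordinates indexed by the `rank`-element subsets of `E` that satisfies the tropical Plücker
relations. -/
structure ValuatedMatroid (E : Type*) [DecidableEq E] where
  /-- the rank -/
  rank : ℕ
  /-- the vector of Plücker coordinates, up to tropical scaling -/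
  point : TropProj {B : Finset E // B.card = rank}
  /-- the tropical Plücker relations -/
  plucker : point.IsPlucker

namespace ValuatedMatroid

variable {E : Type*} [DecidableEq E]

/-- A set is a basis if its Plücker coordinate is finite. -/
def IsBasis (V : ValuatedMatroid E) (S : Set E) : Prop :=
  ∃ B : {B : Finset E // B.card = V.rank}, (B.1 : Set E) = S ∧ ¬ V.point.IsInf B

theorem isBasis_exchange (V : ValuatedMatroid E) : Matroid.ExchangeProperty V.IsBasis := by
  obtain ⟨d, x, hx⟩ := V
  induction x using Quotient.inductionOn with
  | h p =>
    rintro _ _ ⟨⟨X, hXc⟩, rfl, hX⟩ ⟨⟨Y, hYc⟩, rfl, hY⟩ e ⟨heX, heY⟩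
    replace hX : p.1 ⟨X, hXc⟩ ≠ ⊤ := hX
    replace hY : p.1 ⟨Y, hYc⟩ ≠ ⊤ := hY
    replace hx : PluckerRel p.1 := hx
    simp only [Finset.mem_coe] at heX heY hXc hYc
    have hA : (X.erase e).card + 1 = d := by rw [Finset.card_erase_add_one heX, hXc]
    have hC : (insert e Y).card = d + 1 := by rw [Finset.card_insert_of_notMem heY, hYc]
    obtain ⟨i, hi, j, hj, hij, h₁, h₂⟩ := hx _ _ hA hC
    have he : e ∈ insert e Y \ X.erase e := by simp
    have hfin : pluckerCoord p.1 (insert e (X.erase e))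
        + pluckerCoord p.1 ((insert e Y).erase e) ≠ ⊤ := by
      rw [Finset.insert_erase heX, Finset.erase_insert heY]
      simp [pluckerCoord, hXc, hYc, hX, hY]
    have main : ∀ k ∈ insert e Y \ X.erase e, k ≠ e →
        pluckerCoord p.1 (insert k (X.erase e)) + pluckerCoord p.1 ((insert e Y).erase k) ≠ ⊤ →
        ∃ f, f ∈ (Y : Set E) \ X ∧
          IsBasis ⟨d, Quotient.mk _ p, hx⟩ (insert f ((X : Set E) \ {e})) := by
      intro k hk hke hkfin
      simp only [Finset.mem_sdiff, Finset.mem_insert, Finset.mem_erase, hke, false_or, ne_eq,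
        not_false_eq_true, true_and] at hk
      refine ⟨k, ⟨by simpa using hk.1, by simpa using hk.2⟩, ?_⟩
      have hc : (insert k (X.erase e)).card = d := by
        rw [Finset.card_insert_of_notMem (by simp [hk.2]), hA]
      refine ⟨⟨insert k (X.erase e), hc⟩, by simp, ?_⟩
      have h3 := (WithTop.add_ne_top.1 hkfin).1
      rw [pluckerCoord, dif_pos hc] at h3
      exact h3
    by_cases hie : i = e
    · exact main j hj (fun h => hij (hie.trans h.symm)) (ne_top_of_le_ne_top hfin (h₂ e he))
    · exact main i hi hie (ne_top_of_le_ne_top hfin (h₁ e he))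

variable [Fintype E]

/-- The matroid underlying `V`. -/
noncomputable def underlying (V : ValuatedMatroid E) : Matroid E :=
  Matroid.ofIsBaseOfFinite (Set.finite_univ (α := E)) V.IsBasis
    (by
      obtain ⟨B, hB⟩ := V.point.exists_not_isInf
      exact ⟨_, B, rfl, hB⟩)
    V.isBasis_exchange (fun _ _ => Set.subset_univ _)

theorem underlying_isBase (V : ValuatedMatroid E) (S : Set E) :
    V.underlying.IsBase S ↔ V.IsBasis S := by
  simp [underlying]

theorem underlying_ground (V : ValuatedMatroid E) : V.underlying.E = Set.univ := rfl

theorem rank_le (V : ValuatedMatroid E) : V.rank ≤ Fintype.card E := by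
  obtain ⟨B, -⟩ := V.point.exists_not_isInf
  exact B.2 ▸ B.1.card_le_univ

/-- The complement of an `(n - d)`-element set, as a `d`-element set. -/
def complSub (V : ValuatedMatroid E) (B : {B : Finset E // B.card = Fintype.card E - V.rank}) :
    {B : Finset E // B.card = V.rank} :=
  ⟨B.1ᶜ, by rw [Finset.card_compl, B.2, Nat.sub_sub_self V.rank_le]⟩

/-- The dual `V*` of rank `n - d`, with `(V*)_B = V_{E \ B}`. -/
def dual (V : ValuatedMatroid E) : ValuatedMatroid E where
  rank := Fintype.card E - V.rank
  point := V.point.comap V.complSub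
    (by
      obtain ⟨B, hB⟩ := V.point.exists_not_isInf
      refine ⟨⟨B.1ᶜ, by rw [Finset.card_compl, B.2]⟩, ?_⟩
      have : V.complSub ⟨B.1ᶜ, by rw [Finset.card_compl, B.2]⟩ = B :=
        Subtype.ext (compl_compl B.1)
      rwa [this])
  plucker := V.plucker.comap _ _ fun p hx => by
    have hn := V.rank_le
    intro A C hA hC
    have hA' := Finset.card_compl A
    have hC' := Finset.card_compl C
    have hCn := C.card_le_univ
    obtain ⟨i, hi, j, hj, hij, h₁, h₂⟩ := hx Cᶜ Aᶜ (by omega) (by omega)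
    have hs : Aᶜ \ Cᶜ = C \ A := by
      ext k; simp [and_comm]
    rw [hs] at hi hj h₁ h₂
    have key : ∀ k ∈ C \ A, ∀ q : {B : Finset E // B.card = Fintype.card E - V.rank} → WithTop ℝ,
        (∀ B h h', q ⟨B, h⟩ = p ⟨Bᶜ, h'⟩) →
        pluckerCoord q (insert k A) + pluckerCoord q (C.erase k)
          = pluckerCoord p (insert k Cᶜ) + pluckerCoord p (Aᶜ.erase k) := by
      intro k hk q hq
      simp only [Finset.mem_sdiff] at hk
      have c₁ : (insert k A).card = Fintype.card E - V.rank := by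
        rw [Finset.card_insert_of_notMem hk.2, hA]
      have c₂ : (C.erase k).card = Fintype.card E - V.rank := by
        rw [Finset.card_erase_of_mem hk.1, hC]; rfl
      have e₁ : (insert k A)ᶜ = Aᶜ.erase k := by
        ext l; simp
      have e₂ : (C.erase k)ᶜ = insert k Cᶜ := by
        ext l; simp only [Finset.mem_compl, Finset.mem_erase, Finset.mem_insert]; tauto
      have c₃ : (Aᶜ.erase k).card = V.rank := by
        rw [← e₁, Finset.card_compl, c₁]; omega
      have c₄ : (insert k Cᶜ).card = V.rank := by
        rw [← e₂, Finset.card_compl, c₂]; omega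
      rw [pluckerCoord, dif_pos c₁, pluckerCoord, dif_pos c₂, pluckerCoord, dif_pos c₄,
        pluckerCoord, dif_pos c₃, hq _ c₁ (by rw [e₁, c₃]), hq _ c₂ (by rw [e₂, c₄]), add_comm]
      simp only [e₁, e₂]
    refine ⟨i, hi, j, hj, hij, fun k hk => ?_, fun k hk => ?_⟩ <;> dsimp only
    · rw [key i hi _ (fun _ _ _ => rfl), key k hk _ (fun _ _ _ => rfl)]
      exact h₁ k hk
    · rw [key j hj _ (fun _ _ _ => rfl), key k hk _ (fun _ _ _ => rfl)]
      exact h₂ k hk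

theorem exists_contract_base (V : ValuatedMatroid E) (J : Finset E) :
    ∃ Bc : Finset E, (V.underlying.contract (J : Set E)).IsBase (Bc : Set E) := by
  obtain ⟨B, hB⟩ := (V.underlying.contract (J : Set E)).exists_isBase
  exact ⟨(Set.toFinite B).toFinset, by simpa using hB⟩

/-- A basis `B_c` of the contraction of `J` in the underlying matroid. -/
noncomputable def contractBase (V : ValuatedMatroid E) (J : Finset E) : Finset E :=
  Classical.choose (V.exists_contract_base J)

theorem contractBase_isBase (V : ValuatedMatroid E) (J : Finset E) :
    (V.underlying.contract (J : Set E)).IsBase (V.contractBase J : Set E) :=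
  Classical.choose_spec (V.exists_contract_base J)

theorem contractBase_disjoint (V : ValuatedMatroid E) (J : Finset E) :
    Disjoint J (V.contractBase J) := by
  have h := (V.contractBase_isBase J).subset_ground
  rw [Matroid.contract_ground, Set.subset_sdiff] at h
  exact (Finset.disjoint_coe.1 h.2).symm

theorem exists_union_contractBase (V : ValuatedMatroid E) (J : Finset E) :
    ∃ I ⊆ J, V.IsBasis ((I ∪ V.contractBase J : Finset E) : Set E) := by
  obtain ⟨I, hI⟩ := V.underlying.exists_isBasis (J : Set E) (Set.subset_univ _)
  have hbase := V.contractBase_isBase J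
  have hind := (hI.contract_indep_iff.1 hbase.indep).1
  obtain ⟨B, hB, hsub⟩ := hind.exists_isBase_superset
  have hBI : ((B \ J : Set E)) ∪ I ⊆ B :=
    Set.union_subset Set.sdiff_subset (Set.subset_union_right.trans hsub)
  have h1 : (V.underlying.contract (J : Set E)).Indep (B \ J) :=
    hI.contract_indep_iff.2 ⟨hB.indep.subset hBI, Set.disjoint_sdiff_right⟩
  have h2 : (V.contractBase J : Set E) = B \ J := by
    refine hbase.eq_of_subset_indep h1 (Set.subset_sdiff.2 ⟨?_, ?_⟩)
    · exact Set.subset_union_left.trans hsub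
    · exact (Finset.disjoint_coe.2 (V.contractBase_disjoint J)).symm
  have h3 : I = B ∩ J := by
    refine hI.eq_of_subset_indep (hB.indep.subset Set.inter_subset_left) ?_ Set.inter_subset_right
    exact Set.subset_inter (Set.subset_union_right.trans hsub) hI.subset
  refine ⟨(Set.toFinite I).toFinset, ?_, ?_⟩
  · intro i hi
    exact hI.subset (by simpa using hi)
  · rw [← underlying_isBase]
    have : ((((Set.toFinite I).toFinset ∪ V.contractBase J : Finset E)) : Set E) = B := by
      rw [Finset.coe_union, Set.Finite.coe_toFinset, h2, h3, Set.inter_union_sdiff]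
    rw [this]
    exact hB

theorem contractBase_card_le (V : ValuatedMatroid E) (J : Finset E) :
    (V.contractBase J).card ≤ V.rank := by
  obtain ⟨I, -, B, hB, -⟩ := V.exists_union_contractBase J
  rw [← B.2, Finset.coe_injective hB]
  exact Finset.card_le_card Finset.subset_union_right

/-- The set `B ∪ B_c`, for a subset `B` of `J`. -/
noncomputable def extend (V : ValuatedMatroid E) (J : Finset E) (B : Finset J) : Finset E :=
  B.map (Function.Embedding.subtype (· ∈ J)) ∪ V.contractBase J

theorem mem_extend (V : ValuatedMatroid E) (J : Finset E) (B : Finset J) (i : E) :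
    i ∈ V.extend J B ↔ (∃ h : i ∈ J, (⟨i, h⟩ : J) ∈ B) ∨ i ∈ V.contractBase J := by
  simp [extend]

theorem card_extend (V : ValuatedMatroid E) (J : Finset E) (B : Finset J) :
    (V.extend J B).card = B.card + (V.contractBase J).card := by
  rw [extend, Finset.card_union_of_disjoint, Finset.card_map]
  refine (V.contractBase_disjoint J).mono_left ?_
  intro i hi
  obtain ⟨j, -, rfl⟩ := Finset.mem_map.1 hi
  exact j.2

/-- The set `B ∪ B_c`, as a `d`-element set, for a subset `B` of `J` with `d - |B_c|` elements. -/
noncomputable def extendSub (V : ValuatedMatroid E) (J : Finset E)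
    (B : {B : Finset J // B.card = V.rank - (V.contractBase J).card}) :
    {B : Finset E // B.card = V.rank} :=
  ⟨V.extend J B.1, by rw [card_extend, B.2, Nat.sub_add_cancel (V.contractBase_card_le J)]⟩

/-- The restriction of `V` to `J`, of rank `d - |B_c|`, with coordinates
`(V|J)_B = V_{B ∪ B_c}`, where `B_c` is a basis of the contraction of `J` in the underlying
matroid. Another choice of `B_c` changes all coordinates by the same summand. -/
noncomputable def restrict (V : ValuatedMatroid E) (J : Finset E) : ValuatedMatroid J where
  rank := V.rank - (V.contractBase J).card
  point := V.point.comap (V.extendSub J)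
    (by
      obtain ⟨I, hIJ, B, hB, hfin⟩ := V.exists_union_contractBase J
      have hB' : B.1 = I ∪ V.contractBase J := Finset.coe_injective hB
      have hext : V.extend J (Finset.univ.filter fun i : J => (i : E) ∈ I) = B.1 := by
        ext i
        rw [mem_extend, hB', Finset.mem_union]
        constructor
        · rintro (⟨h, h'⟩ | h)
          · exact Or.inl (Finset.mem_filter.1 h').2
          · exact Or.inr h
        · rintro (h | h)
          · exact Or.inl ⟨hIJ h, Finset.mem_filter.2 ⟨Finset.mem_univ _, h⟩⟩
          · exact Or.inr h
      have hc := V.card_extend J (Finset.univ.filter fun i : J => (i : E) ∈ I)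
      rw [hext, B.2] at hc
      refine ⟨⟨Finset.univ.filter fun i : J => (i : E) ∈ I, by omega⟩, ?_⟩
      have : V.extendSub J ⟨Finset.univ.filter fun i : J => (i : E) ∈ I, by omega⟩ = B :=
        Subtype.ext hext
      rwa [this])
  plucker := V.plucker.comap _ _ fun p hx => by
    have hle := V.contractBase_card_le J
    have hcard := V.card_extend J
    have hmem := V.mem_extend J
    have hdis := V.contractBase_disjoint J
    intro A C hA hC
    obtain ⟨i, hi, j, hj, hij, h₁, h₂⟩ := hx (V.extend J A) (V.extend J C)
      (by rw [hcard]; omega) (by rw [hcard]; omega)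
    have hsub : ∀ k ∈ V.extend J C \ V.extend J A, ∃ h : k ∈ J, (⟨k, h⟩ : J) ∈ C \ A := by
      intro k hk
      rw [Finset.mem_sdiff, hmem, hmem] at hk
      obtain ⟨⟨h, hkC⟩ | hk1, hk2⟩ := hk
      · exact ⟨h, Finset.mem_sdiff.2 ⟨hkC, fun hkA => hk2 (Or.inl ⟨h, hkA⟩)⟩⟩
      · exact absurd (Or.inr hk1) hk2
    have hnot : ∀ k : J, (k : E) ∉ V.contractBase J := fun k => Finset.disjoint_left.1 hdis k.2
    have hsub' : ∀ k ∈ C \ A, (k : E) ∈ V.extend J C \ V.extend J A := by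
      intro k hk
      rw [Finset.mem_sdiff] at hk
      rw [Finset.mem_sdiff, hmem, hmem]
      refine ⟨Or.inl ⟨k.2, hk.1⟩, ?_⟩
      rintro (⟨_, h⟩ | h)
      · exact hk.2 h
      · exact hnot k h
    have key : ∀ k ∈ C \ A, ∀ q : {B : Finset J // B.card = V.rank - (V.contractBase J).card} → WithTop ℝ,
        (∀ B h h', q ⟨B, h⟩ = p ⟨V.extend J B, h'⟩) →
        pluckerCoord q (insert k A) + pluckerCoord q (C.erase k)
          = pluckerCoord p (insert (k : E) (V.extend J A)) + pluckerCoord p ((V.extend J C).erase k) := by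
      intro k hk q hq
      rw [Finset.mem_sdiff] at hk
      have c₁ : (insert k A).card = V.rank - (V.contractBase J).card := by
        rw [Finset.card_insert_of_notMem hk.2, hA]
      have c₂ : (C.erase k).card = V.rank - (V.contractBase J).card := by
        rw [Finset.card_erase_of_mem hk.1, hC]; rfl
      have e₁ : V.extend J (insert k A) = insert (k : E) (V.extend J A) := by
        ext l
        rw [hmem, Finset.mem_insert, hmem]
        simp only [Finset.mem_insert, Subtype.ext_iff]
        constructor
        · rintro (⟨h, h' | h'⟩ | h)
          · exact Or.inl h'
          · exact Or.inr (Or.inl ⟨h, h'⟩)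
          · exact Or.inr (Or.inr h)
        · rintro (h | ⟨h, h'⟩ | h)
          · exact Or.inl ⟨h ▸ k.2, Or.inl h⟩
          · exact Or.inl ⟨h, Or.inr h'⟩
          · exact Or.inr h
      have e₂ : V.extend J (C.erase k) = (V.extend J C).erase k := by
        ext l
        rw [hmem, Finset.mem_erase, hmem]
        simp only [Finset.mem_erase, ne_eq, Subtype.ext_iff]
        constructor
        · rintro (⟨h, h', h''⟩ | h)
          · exact ⟨h', Or.inl ⟨h, h''⟩⟩
          · exact ⟨fun hl => hnot k (hl ▸ h), Or.inr h⟩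
        · rintro ⟨h, ⟨h', h''⟩ | h'⟩
          · exact Or.inl ⟨h', h, h''⟩
          · exact Or.inr h'
      have c₃ : (insert (k : E) (V.extend J A)).card = V.rank := by
        rw [← e₁, hcard, c₁]; omega
      have c₄ : ((V.extend J C).erase (k : E)).card = V.rank := by
        rw [← e₂, hcard, c₂]; omega
      rw [pluckerCoord, dif_pos c₁, pluckerCoord, dif_pos c₂, pluckerCoord, dif_pos c₃,
        pluckerCoord, dif_pos c₄, hq _ c₁ (by rw [e₁, c₃]), hq _ c₂ (by rw [e₂, c₄])]
      simp only [e₁, e₂]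
    obtain ⟨hiJ, hi'⟩ := hsub i hi
    obtain ⟨hjJ, hj'⟩ := hsub j hj
    refine ⟨⟨i, hiJ⟩, hi', ⟨j, hjJ⟩, hj', fun h => hij (congrArg Subtype.val h),
      fun k hk => ?_, fun k hk => ?_⟩ <;> dsimp only
    · rw [key _ hi' _ (fun _ _ _ => rfl), key k hk _ (fun _ _ _ => rfl)]
      exact h₁ k (hsub' k hk)
    · rw [key _ hj' _ (fun _ _ _ => rfl), key k hk _ (fun _ _ _ => rfl)]
      exact h₂ k (hsub' k hk)

/-- The contraction `V/J = (V*|(E \ J))*`, a valuated matroid on `E \ J`. -/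
noncomputable def contract (V : ValuatedMatroid E) (J : Finset E) :
    ValuatedMatroid (Jᶜ : Finset E) :=
  (V.dual.restrict Jᶜ).dual

/-- The tropical maximal minors of a tropical matrix: the coordinate at `B` is the minimum of
`∑ i, A i (j i)` over all `(j_1, …, j_d)` with `{j_1, …, j_d} = B`. -/
def stiefelVec {d : ℕ} (A : Matrix (Fin d) E (WithTop ℝ)) (B : {B : Finset E // B.card = d}) :
    WithTop ℝ :=
  (Finset.univ.filter fun j : Fin d → E => Finset.univ.image j = B.1).inf
    fun j => ∑ i, A i (j i)

/-- The multiset `𝒜` of points of tropical projective space is a (transversal) presentation of `V`: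
it is the multiset of the points given by the rows of a `d × n` tropical matrix `A`, where
`d = rank V`, that lies in the domain of the tropical Stiefel map (some maximal minor is finite) and
whose image under that map is `V`. -/
def IsPresentation (V : ValuatedMatroid E) (𝒜 : Multiset (TropProj E)) : Prop :=
  ∃ A : Fin V.rank → TropVec E,
    Finset.univ.val.map (fun i => TropProj.mk (A i)) = 𝒜 ∧
    ∃ h : ∃ B, stiefelVec (fun i => (A i).1) B ≠ ⊤,
      TropProj.mk ⟨stiefelVec (fun i => (A i).1), h⟩ = V.point

end ValuatedMatroid

/-- A cyclic flat of a matroid: a flat whose complement is a flat of the dual matroid. -/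
def Matroid.IsCyclicFlat {α : Type*} (M : Matroid α) (F : Set α) : Prop :=
  M.IsFlat F ∧ M✶.IsFlat (M.E \ F)

/-! Join row `i` of the matrix `A` to `x` whenever `A i x` is finite. The finite minors are those
whose columns can be matched to all rows, so the underlying matroid is the transversal matroid of
this bipartite graph. By Mendelsohn–Dulmage, its independent sets are exactly the sets of columns
that can be matched.

Let `R` be the set of rows with a finite entry in `F`. Matching a basis of `F` gives `k ≤ |R|`. For
the reverse bound (`card_neighbors_le`), the defect form of Hall's theorem yields `X ⊆ F` with
`|N(X)| + |F \ X| ≤ k`. Cyclicity forces `X = F`: a basis of `F` that avoids some `e ∈ F \ X` would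
have fewer than `k` elements. So exactly `d - k` rows are infinite on `F`.

Now let `I` be a basis of `F`. In a finite term of the minor at `B ∪ I`, with `B` disjoint from `F`,
the columns `I` can only be matched to the rows `R`, and they use all of them. The minor is
therefore a constant plus the minor at `B` of the remaining rows (`stiefelVec_union`). Since `V/F`
has coordinates `V_{B ∪ I}`, these rows present it, and the constant disappears projectively. -/

/-! ### Tropical minors and matchings -/

theorem ValuatedMatroid.stiefelVec_ne_top_iff {E : Type*} [DecidableEq E] [Fintype E] {d : ℕ}
    (A : Matrix (Fin d) E (WithTop ℝ)) (B : {B : Finset E // B.card = d}) :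
    ValuatedMatroid.stiefelVec A B ≠ ⊤ ↔
      ∃ j : Fin d → E, Function.Injective j ∧ Finset.univ.image j = B.1 ∧
        ∀ i, A i (j i) ≠ ⊤ := by
  rw [ValuatedMatroid.stiefelVec, ne_eq, Finset.inf_eq_top_iff]
  push Not
  constructor
  · rintro ⟨j, hj, hs⟩
    have hj' := (Finset.mem_filter.1 hj).2
    refine ⟨j, ?_, hj', fun i => WithTop.sum_ne_top.1 hs i (Finset.mem_univ i)⟩
    exact Set.injOn_univ.1 (by
      simpa using (Finset.card_image_iff (f := j) (s := Finset.univ)).1 (by rw [hj', B.2]; simp))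
  · rintro ⟨j, -, hj, hs⟩
    exact ⟨j, by simpa using hj, WithTop.sum_ne_top.2 fun i _ => hs i⟩

/-- If the rows outside `R` are infinite on `F` and `I ⊆ F` has as many elements as `R`,
then the maximal minors at `B ∪ I` with `B` disjoint from `F` factor. -/
theorem ValuatedMatroid.stiefelVec_union {E : Type*} [DecidableEq E] [Fintype E] {d d' : ℕ}
    (A : Matrix (Fin d) E (WithTop ℝ)) {F : Finset E} {R : Finset (Fin d)}
    (hR : ∀ i ∉ R, ∀ x ∈ F, A i x = ⊤) (e : Fin d' ≃ {i : Fin d // i ∉ R})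
    {I : Finset E} (hIF : I ⊆ F) (hI : I.card = R.card)
    (B : {B : Finset (Fᶜ : Finset E) // B.card = d'}) (B' : {B : Finset E // B.card = d})
    (hB : B'.1 = B.1.map (Function.Embedding.subtype (· ∈ Fᶜ)) ∪ I) :
    stiefelVec A B' =
      ((Finset.univ.filter fun j : {i // i ∈ R} → E => Finset.univ.image j = I).inf
        fun j => ∑ i, A i.1 (j i)) +
      stiefelVec (fun i (b : (Fᶜ : Finset E)) => A (e i).1 b.1) B := by
  have hsplit : ∀ f : Fin d → WithTop ℝ,
      ∑ i, f i = (∑ i : {i // i ∈ R}, f i) + ∑ i : Fin d', f (e i) := fun f => by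
    rw [e.sum_comp fun i : {i // i ∉ R} => f i.1, ← Fintype.sum_subtype_add_sum_subtype (· ∈ R) f]
    congr!
  apply le_antisymm
  · set s := Finset.univ.filter fun j : {i // i ∈ R} → E => Finset.univ.image j = I with hs
    set t := Finset.univ.filter fun j : Fin d' → (Fᶜ : Finset E) =>
      Finset.univ.image j = B.1 with ht
    rcases s.eq_empty_or_nonempty with h1 | h1
    · simp [h1]
    rcases t.eq_empty_or_nonempty with h2 | h2
    · simp [stiefelVec, ← ht, h2]
    obtain ⟨j₁, hj₁, e₁⟩ := s.exists_mem_eq_inf h1 fun j => ∑ i, A i.1 (j i)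
    obtain ⟨j₂, hj₂, e₂⟩ := t.exists_mem_eq_inf h2 fun j => ∑ i, A (e i).1 (j i).1
    unfold stiefelVec
    rw [← ht, e₁, e₂]
    replace hj₁ := (Finset.mem_filter.1 hj₁).2
    replace hj₂ := (Finset.mem_filter.1 hj₂).2
    -- Optimal selections for the two blocks are glued into one selection for the whole matrix.
    let j : Fin d → E := fun i => if h : i ∈ R then j₁ ⟨i, h⟩ else (j₂ (e.symm ⟨i, h⟩)).1
    have hj1 : ∀ i : {i // i ∈ R}, j i.1 = j₁ i := fun i => by simp [j]
    have hj2 : ∀ i : {i // i ∉ R}, j i.1 = (j₂ (e.symm i)).1 := fun i => by simp [j, i.2]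
    refine (Finset.inf_le (b := j) ?_).trans_eq ?_
    · rw [Finset.mem_filter, hB, ← hj₁, ← hj₂]
      refine ⟨Finset.mem_univ _, ?_⟩
      ext x
      simp only [Finset.mem_image, Finset.mem_univ, true_and, Finset.mem_union, Finset.mem_map,
        Function.Embedding.subtype_apply]
      constructor
      · rintro ⟨i, rfl⟩
        by_cases h : i ∈ R
        · exact Or.inr ⟨⟨i, h⟩, (hj1 ⟨i, h⟩).symm⟩
        · exact Or.inl ⟨_, ⟨_, rfl⟩, (hj2 ⟨i, h⟩).symm⟩
      · rintro (⟨_, ⟨i, rfl⟩, rfl⟩ | ⟨i, rfl⟩)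
        · exact ⟨(e i).1, by rw [hj2, e.symm_apply_apply]⟩
        · exact ⟨i.1, hj1 i⟩
    · rw [hsplit]
      simp only [hj1, hj2, e.symm_apply_apply]
  · refine Finset.le_inf fun j hj => ?_
    replace hj := (Finset.mem_filter.1 hj).2
    by_cases htop : ∑ i, A i (j i) = ⊤
    · rw [htop]; exact le_top
    have hfin : ∀ i, A i (j i) ≠ ⊤ := fun i => WithTop.sum_ne_top.1 htop i (Finset.mem_univ i)
    have hinj : Function.Injective j :=
      Set.injOn_univ.1 (by
        simpa using (Finset.card_image_iff (f := j) (s := Finset.univ)).1 (by rw [hj, B'.2]; simp))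
    -- A row sent into `I ⊆ F` by a finite term must lie in `R`. Every element of `I` is hit, so
    -- `|I| = |R|` leaves no row of `R` over.
    have hIR : (Finset.univ.filter fun i => j i ∈ I) = R := by
      apply Finset.eq_of_subset_of_card_le
      · intro i hi
        by_contra h
        exact hfin i (hR i h _ (hIF (Finset.mem_filter.1 hi).2))
      · rw [← hI]
        refine (Finset.card_le_card (t := (Finset.univ.filter fun i => j i ∈ I).image j) ?_).trans
          Finset.card_image_le
        intro x hx
        have : x ∈ Finset.univ.image j := by rw [hj, hB]; exact Finset.mem_union_right _ hx
        obtain ⟨i, -, rfl⟩ := Finset.mem_image.1 this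
        exact Finset.mem_image_of_mem _ (by simpa using hx)
    have hmem : ∀ i, j i ∈ I ↔ i ∈ R := fun i => by rw [← hIR]; simp
    have hout : ∀ i : {i // i ∉ R}, ∃ h : j i.1 ∈ Fᶜ, (⟨j i.1, h⟩ : (Fᶜ : Finset E)) ∈ B.1 := by
      intro i
      have : j i.1 ∈ Finset.univ.image j := Finset.mem_image_of_mem _ (Finset.mem_univ _)
      rw [hj, hB, Finset.mem_union, hmem] at this
      obtain ⟨b, hb, hbi⟩ := Finset.mem_map.1 (this.resolve_right i.2)
      rw [← hbi]
      exact ⟨b.2, hb⟩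
    rw [hsplit]
    refine add_le_add
      (Finset.inf_le (f := fun j : {i // i ∈ R} → E => ∑ i, A i.1 (j i)) (b := fun i => j i.1) ?_)
      (Finset.inf_le (f := fun j : Fin d' → (Fᶜ : Finset E) => ∑ i, A (e i).1 (j i).1)
        (b := fun i => ⟨j (e i).1, (hout (e i)).1⟩) ?_)
    · rw [Finset.mem_filter]
      refine ⟨Finset.mem_univ _, ?_⟩
      ext x
      simp only [Finset.mem_image, Finset.mem_univ, true_and]
      constructor
      · rintro ⟨i, rfl⟩
        exact (hmem _).2 i.2
      · intro hx
        have : x ∈ Finset.univ.image j := by rw [hj, hB]; exact Finset.mem_union_right _ hx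
        obtain ⟨i, -, rfl⟩ := Finset.mem_image.1 this
        exact ⟨⟨i, (hmem i).1 hx⟩, rfl⟩
    · rw [Finset.mem_filter]
      refine ⟨Finset.mem_univ _, ?_⟩
      ext x
      simp only [Finset.mem_image, Finset.mem_univ, true_and]
      constructor
      · rintro ⟨i, rfl⟩
        exact (hout (e i)).2
      · intro hx
        have : x.1 ∈ Finset.univ.image j := by
          rw [hj, hB]
          exact Finset.mem_union_left _ (Finset.mem_map.2 ⟨x, hx, rfl⟩)
        obtain ⟨i, -, hi⟩ := Finset.mem_image.1 this
        have hiR : i ∉ R := fun h =>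
          Finset.mem_compl.1 x.2 (hIF (hi ▸ (hmem i).2 h))
        exact ⟨e.symm ⟨i, hiR⟩, Subtype.ext (by simpa using hi)⟩

/-! ### Matchings in bipartite graphs -/

/-- The Mendelsohn–Dulmage theorem: if all rows can be matched, and all of `Y` can be matched, then
there is a matching that covers all rows and all of `Y`. -/
theorem exists_matching_covering {ρ E : Type*} (r : ρ → E → Prop) {f : ρ → E}
    (hf : Function.Injective f) (hfr : ∀ i, r i (f i)) {Y : Set E} {g : Y → ρ}
    (hg : Function.Injective g) (hgr : ∀ y, r (g y) y) :
    ∃ j : ρ → E, Function.Injective j ∧ (∀ i, r i (j i)) ∧ Y ⊆ Set.range j := by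
  classical
  -- As in the Schröder–Bernstein theorem, a fixed point `P` of this monotone map says that the rows
  -- outside `P` are exactly those that `g` assigns to elements of `Y` outside `f '' P`. Rows in `P`
  -- follow `f` and the others follow the inverse of `g`, without collisions.
  let φ : Set ρ →o Set ρ :=
    ⟨fun P => (g '' {y | (y : E) ∉ f '' P})ᶜ, fun P Q h =>
      Set.compl_subset_compl.2 (Set.image_mono fun y hy hP => hy (Set.image_mono h hP))⟩
  obtain ⟨P, hP⟩ : ∃ P, φ P = P := ⟨_, φ.map_lfp⟩
  have hPc : ∀ i, i ∉ P ↔ ∃ y : Y, (y : E) ∉ f '' P ∧ g y = i := by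
    intro i
    nth_rw 1 [← hP]
    simp [φ]
  choose y hy hgy using fun i => (hPc i).1
  refine ⟨fun i => if h : i ∈ P then f i else y i h, ?_, ?_, ?_⟩
  · intro a b hab
    by_cases ha : a ∈ P <;> by_cases hb : b ∈ P <;> simp only [ha, hb, dite_true, dite_false] at hab
    · exact hf hab
    · exact absurd ⟨a, ha, hab⟩ (hy b hb)
    · exact absurd ⟨b, hb, hab.symm⟩ (hy a ha)
    · exact (hgy a ha).symm.trans ((congrArg g (Subtype.ext hab)).trans (hgy b hb))
  · intro i
    by_cases hi : i ∈ P
    · simpa [hi] using hfr i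
    · have := hgr (y i hi)
      rw [hgy i hi] at this
      simpa [hi] using this
  · intro x hx
    by_cases h : x ∈ f '' P
    · obtain ⟨i, hi, rfl⟩ := h
      exact ⟨i, by simp [hi]⟩
    · have hi := (hPc (g ⟨x, hx⟩)).2 ⟨⟨x, hx⟩, h, rfl⟩
      exact ⟨g ⟨x, hx⟩, by simp only [hi, dite_false, hg (hgy _ hi)]⟩

/-- If no matching into `F` has more than `k` elements, and for all `e ∈ F` some `k` elements of
`F \ {e}` can be matched, then `F` has at most `k` neighbours. -/
theorem card_neighbors_le {ρ E : Type*} [DecidableEq E] [Fintype ρ] [DecidableEq ρ]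
    (r : ρ → E → Prop) [∀ i x, Decidable (r i x)] (F : Finset E) (k : ℕ)
    (hmax : ∀ Y ⊆ F, (∃ g : {x // x ∈ Y} → ρ, Function.Injective g ∧ ∀ y, r (g y) y) → Y.card ≤ k)
    (hcyc : ∀ e ∈ F, ∃ I ⊆ F, e ∉ I ∧ I.card = k ∧
      ∃ g : {x // x ∈ I} → ρ, Function.Injective g ∧ ∀ y, r (g y) y) :
    (Finset.univ.filter fun i => ∃ x ∈ F, r i x).card ≤ k := by
  rcases F.eq_empty_or_nonempty with rfl | ⟨e₀, he₀⟩
  · simp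
  -- This makes the natural subtraction `F.card - (k + 1)` below exact.
  have hkF : k + 1 ≤ F.card := by
    obtain ⟨I, hI, heI, hc, -⟩ := hcyc e₀ he₀
    rw [← hc]
    exact Finset.card_lt_card (Finset.ssubset_iff_subset_ne.2 ⟨hI, fun h => heI (h ▸ he₀)⟩)
  let N : E → Finset ρ := fun x => Finset.univ.filter fun i => r i x
  obtain ⟨X, hXF, hX⟩ : ∃ X ⊆ F, (X.biUnion N).card + (F \ X).card ≤ k := by
    by_contra! hcon
    -- Hall's theorem is applied after adding `|F| - (k + 1)` dummy rows joined to all of `F`. A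
    -- matching of `F` then sends at least `k + 1` elements to genuine rows, against `hmax`.
    have hall := (Finset.all_card_le_biUnion_card_iff_exists_injective
      (fun x : F => (N x).disjSum (Finset.univ : Finset (Fin (F.card - (k + 1)))))).1 ?_
    · obtain ⟨f, hf, hfN⟩ := hall
      let T : Finset F := Finset.univ.filter fun x => (f x).isLeft
      have hT : k + 1 ≤ T.card := by
        have h1 : (Finset.univ.filter fun x : F => ¬ (f x).isLeft).card ≤ F.card - (k + 1) := by
          calc _ ≤ ((Finset.univ : Finset (Fin (F.card - (k + 1)))).map
                  ⟨Sum.inr (α := ρ), Sum.inr_injective⟩).card := by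
                refine Finset.card_le_card_of_injOn f ?_ hf.injOn
                intro x hx
                have hx' : ¬ (f x).isLeft := (Finset.mem_filter.1 hx).2
                cases h : f x with
                | inl a => simp [h] at hx'
                | inr a => simp
            _ = _ := by simp
        have h2 := Finset.card_filter_add_card_filter_not (s := (Finset.univ : Finset F))
          fun x => (f x).isLeft
        simp only [Finset.card_univ, Fintype.card_coe] at h2
        change _ ≤ (Finset.univ.filter fun x : F => (f x).isLeft).card
        omega
      have hTr : ∀ y : {x // x ∈ T.map (Function.Embedding.subtype _)},
          ∃ (h : y.1 ∈ F) (i : ρ), f ⟨y.1, h⟩ = Sum.inl i := by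
        rintro ⟨y, hy⟩
        obtain ⟨x, hx, rfl⟩ := Finset.mem_map.1 hy
        exact ⟨x.2, Sum.isLeft_iff.1 (Finset.mem_filter.1 hx).2⟩
      choose hF g hg using hTr
      have hle := hmax (T.map (Function.Embedding.subtype _)) ?_ ⟨g, ?_, ?_⟩
      · rw [Finset.card_map] at hle
        omega
      · intro x hx
        exact hF ⟨x, hx⟩
      · intro a b hab
        have := hf ((hg a).trans ((congrArg Sum.inl hab).trans (hg b).symm))
        exact Subtype.ext (Subtype.mk.inj this)
      · intro y
        have := hfN ⟨y.1, hF y⟩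
        rw [hg y, Finset.inl_mem_disjSum] at this
        exact (Finset.mem_filter.1 this).2
    · intro s
      -- The dummy rows are neighbours of `s` only when `s` has an element.
      rcases s.eq_empty_or_nonempty with rfl | ⟨x₀, hx₀⟩
      · simp
      have hsub : s.map (Function.Embedding.subtype _) ⊆ F := by
        intro x hx
        obtain ⟨y, -, rfl⟩ := Finset.mem_map.1 hx
        exact y.2
      have h1 := hcon _ hsub
      rw [Finset.card_sdiff_of_subset hsub, Finset.card_map] at h1
      have h2 : (((s.map (Function.Embedding.subtype _)).biUnion N).disjSum
          (Finset.univ : Finset (Fin (F.card - (k + 1))))) ⊆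
          s.biUnion fun x => (N x).disjSum (Finset.univ : Finset (Fin (F.card - (k + 1)))) := by
        rintro (i | i) hi
        · rw [Finset.inl_mem_disjSum, Finset.mem_biUnion] at hi
          obtain ⟨x, hx, hi⟩ := hi
          obtain ⟨y, hy, rfl⟩ := Finset.mem_map.1 hx
          exact Finset.mem_biUnion.2 ⟨y, hy, Finset.inl_mem_disjSum.2 hi⟩
        · exact Finset.mem_biUnion.2 ⟨x₀, hx₀, Finset.inr_mem_disjSum.2 (Finset.mem_univ _)⟩
      refine le_trans ?_ (Finset.card_le_card h2)
      rw [Finset.card_disjSum, Finset.card_univ, Fintype.card_fin]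
      have h3 : s.card ≤ F.card := by simpa using Finset.card_le_card hsub
      omega
  -- Otherwise some `I` of size `k` misses an `e ∈ F \ X`, and `k = |I ∩ X| + |I \ X| < |N(X)| + |F
  -- \ X| ≤ k`.
  have hXF' : X = F := by
    by_contra hne
    obtain ⟨e, heF, heX⟩ := Finset.exists_of_ssubset (Finset.ssubset_iff_subset_ne.2 ⟨hXF, hne⟩)
    obtain ⟨I, hIF, heI, hIk, g, hg, hgr⟩ := hcyc e heF
    have h1 : (I ∩ X).card ≤ (X.biUnion N).card := by
      rw [← Finset.card_attach]
      refine Finset.card_le_card_of_injOn (fun x => g ⟨x.1, (Finset.mem_inter.1 x.2).1⟩) ?_ ?_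
      · intro x _
        exact Finset.mem_biUnion.2 ⟨x.1, (Finset.mem_inter.1 x.2).2, by simpa [N] using hgr _⟩
      · intro a _ b _ hab
        exact Subtype.ext (Subtype.mk.inj (hg hab))
    have h2 : (I \ X).card < (F \ X).card := by
      refine Finset.card_lt_card (Finset.ssubset_iff_subset_ne.2
        ⟨Finset.sdiff_subset_sdiff hIF subset_rfl, fun h => ?_⟩)
      have : e ∈ I \ X := h ▸ Finset.mem_sdiff.2 ⟨heF, heX⟩
      exact heI (Finset.mem_sdiff.1 this).1
    have h3 := Finset.card_inter_add_card_sdiff I X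
    omega
  subst hXF'
  refine le_trans (Finset.card_le_card ?_) ((Nat.le_add_right _ _).trans hX)
  intro i hi
  obtain ⟨x, hx, hr⟩ := (Finset.mem_filter.1 hi).2
  exact Finset.mem_biUnion.2 ⟨x, hx, by simpa [N] using hr⟩

/-! ### Pullbacks of coordinates, and duality -/

theorem TropProj.isInf_comap {ι κ : Type*} (f : κ → ι) (x : TropProj ι)
    (h : ∃ k, ¬ x.IsInf (f k)) (k : κ) : (x.comap f h).IsInf k ↔ x.IsInf (f k) := by
  obtain ⟨y, rfl⟩ := Quotient.exists_rep x
  rfl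

theorem TropProj.comap_eq_mk {ι κ : Type*} {x : TropProj ι} {p : ι → WithTop ℝ}
    {h : ∃ i, p i ≠ ⊤} (hx : TropProj.mk ⟨p, h⟩ = x) (f : κ → ι) (hf : ∃ k, ¬ x.IsInf (f k)) :
    ∃ h', x.comap f hf = TropProj.mk ⟨fun k => p (f k), h'⟩ := by
  subst hx
  exact ⟨hf, rfl⟩

/-- Projection needs a proof that a finite coordinate survives. This discards those proofs once the
points are given by rows. -/
theorem Multiset.pmap_map_eq_map {α β γ : Type*} {p : β → Prop} (f : ∀ b, p b → γ) (g : α → β)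
    (s : Multiset α) (H : ∀ b ∈ s.map g, p b) (F : α → γ) (hF : ∀ a h, f (g a) h = F a) :
    (s.map g).pmap f H = s.map F := by
  induction s using Multiset.induction_on with
  | empty => simp
  | cons a s ih =>
    simp only [Multiset.map_cons, Multiset.pmap_cons, hF]
    rw [ih]

namespace ValuatedMatroid

variable {E : Type*} [DecidableEq E] [Fintype E]

theorem dual_isBasis_iff (V : ValuatedMatroid E) (S : Set E) :
    V.dual.IsBasis S ↔ V.IsBasis Sᶜ := by
  constructor
  · rintro ⟨B, rfl, hB⟩
    exact ⟨V.complSub B, by simp [complSub], fun h => hB ((TropProj.isInf_comap _ _ _ _).2 h)⟩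
  · rintro ⟨B, hBS, hB⟩
    have hc : (B.1ᶜ).card = Fintype.card E - V.rank := by rw [Finset.card_compl, B.2]
    refine ⟨⟨B.1ᶜ, hc⟩, by rw [Finset.coe_compl, hBS, compl_compl], fun h => hB ?_⟩
    have h' := (TropProj.isInf_comap _ _ _ _).1 h
    have hB' : V.complSub ⟨B.1ᶜ, hc⟩ = B := Subtype.ext (compl_compl B.1)
    exact hB' ▸ h'

theorem dual_underlying (V : ValuatedMatroid E) : V.dual.underlying = V.underlying✶ := by
  refine Matroid.ext_isBase rfl fun B _ => ?_
  rw [underlying_isBase, dual_isBasis_iff,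
    Matroid.dual_isBase_iff (by rw [underlying_ground]; exact Set.subset_univ _),
    underlying_isBase, underlying_ground, Set.compl_eq_univ_sdiff]

end ValuatedMatroid

/-! ### Cyclic flats and transversal matroids -/

open scoped Matroid in
/-- Complements in `F` of the bases of `M✶ ／ (M.E \ F)` are the bases of `F` in `M`. -/
theorem Matroid.isBasis_sdiff_of_isBase_dual_contract {α : Type*} {M : Matroid α} {F B : Set α}
    (hF : F ⊆ M.E) (hB : (M✶ ／ (M.E \ F)).IsBase B) : M.IsBasis (F \ B) F := by
  rw [← Matroid.dual_delete, Matroid.dual_isBase_iff', Matroid.delete_compl hF,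
    Matroid.restrict_ground_eq] at hB
  exact (Matroid.isBase_restrict_iff hF).1 hB.1

-- Because `M.E \ F` is closed in the dual, contracting it there leaves no loops. Hence `e` lies in
-- a base of that contraction, and the complement of this base in `F` is a basis of `F` avoiding
-- `e`.
open scoped Matroid in
theorem Matroid.IsCyclicFlat.exists_isBasis_notMem {α : Type*} {M : Matroid α} {F : Set α}
    (hF : M.IsCyclicFlat F) {e : α} (he : e ∈ F) : ∃ I, M.IsBasis I F ∧ e ∉ I := by
  have hFE := hF.1.subset_ground
  have hnl : (M✶ ／ (M.E \ F)).IsNonloop e := by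
    rw [Matroid.contract_isNonloop_iff, hF.2.closure]
    exact ⟨hFE he, fun h => h.2 he⟩
  obtain ⟨B, hB, heB⟩ := hnl.exists_mem_isBase
  exact ⟨F \ B, isBasis_sdiff_of_isBase_dual_contract hFE hB, fun h => h.2 heB⟩

namespace ValuatedMatroid

variable {E : Type*} [DecidableEq E] [Fintype E]

theorem isBasis_iff_of_point_eq {V : ValuatedMatroid E} {A : Matrix (Fin V.rank) E (WithTop ℝ)}
    {h : ∃ B, stiefelVec A B ≠ ⊤} (hV : TropProj.mk ⟨stiefelVec A, h⟩ = V.point) (S : Set E) :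
    V.IsBasis S ↔ ∃ j : Fin V.rank → E, Function.Injective j ∧ Set.range j = S ∧
      ∀ i, A i (j i) ≠ ⊤ := by
  rw [IsBasis, ← hV]
  constructor
  · rintro ⟨B, rfl, hB⟩
    obtain ⟨j, hj, hjB, hfin⟩ := (stiefelVec_ne_top_iff A B).1 hB
    exact ⟨j, hj, by simp [← hjB], hfin⟩
  · rintro ⟨j, hj, rfl, hfin⟩
    exact ⟨⟨Finset.univ.image j, by simp [Finset.card_image_of_injective _ hj]⟩, by simp,
      (stiefelVec_ne_top_iff A _).2 ⟨j, hj, rfl, hfin⟩⟩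

/-- A matching of `I` need not extend as it stands. Mendelsohn–Dulmage combines it with a matching
of all rows into one that still covers `I`, and its range is a base. -/
theorem indep_iff_of_point_eq {V : ValuatedMatroid E} {A : Matrix (Fin V.rank) E (WithTop ℝ)}
    {h : ∃ B, stiefelVec A B ≠ ⊤} (hV : TropProj.mk ⟨stiefelVec A, h⟩ = V.point) (I : Finset E) :
    V.underlying.Indep (I : Set E) ↔
      ∃ g : {x // x ∈ I} → Fin V.rank, Function.Injective g ∧ ∀ y, A (g y) y ≠ ⊤ := by
  constructor
  · intro hI
    obtain ⟨B, hB, hIB⟩ := hI.exists_isBase_superset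
    obtain ⟨j, -, rfl, hfin⟩ := (isBasis_iff_of_point_eq hV B).1 ((V.underlying_isBase B).1 hB)
    choose g hg using fun y : {x // x ∈ I} => hIB y.2
    refine ⟨g, fun a b hab => Subtype.ext ?_, fun y => ?_⟩
    · rw [← hg a, ← hg b, hab]
    · have := hfin (g y)
      rwa [hg y] at this
  · rintro ⟨g, hg, hgr⟩
    obtain ⟨f, hf, -, hfr⟩ := (stiefelVec_ne_top_iff A _).1 h.choose_spec
    obtain ⟨j, hj, hjr, hY⟩ := exists_matching_covering (fun i x => A i x ≠ ⊤) hf hfr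
      (Y := (I : Set E)) (g := g) hg hgr
    exact ((V.underlying_isBase _).2
      ((isBasis_iff_of_point_eq hV _).2 ⟨j, hj, rfl, hjr⟩)).indep.subset hY

-- The lower bound comes from matching one basis of `F`. The upper bound is `card_neighbors_le`,
-- whose second hypothesis is where cyclicity enters.
open scoped Classical in
theorem card_rows_meeting_cyclicFlat {V : ValuatedMatroid E}
    {A : Matrix (Fin V.rank) E (WithTop ℝ)}
    {h : ∃ B, stiefelVec A B ≠ ⊤} (hV : TropProj.mk ⟨stiefelVec A, h⟩ = V.point)
    {F : Finset E} (hF : V.underlying.IsCyclicFlat (F : Set E)) {k : ℕ}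
    (hk : V.underlying.eRk (F : Set E) = k) :
    (Finset.univ.filter fun i => ∃ x ∈ F, A i x ≠ ⊤).card = k := by
  have hcard : ∀ I : Finset E, V.underlying.IsBasis (I : Set E) (F : Set E) → I.card = k := by
    intro I hI
    have := hI.encard_eq_eRk
    rwa [hk, Set.encard_coe_eq_coe_finsetCard, Nat.cast_inj] at this
  apply le_antisymm
  · apply card_neighbors_le (fun i x => A i x ≠ ⊤) F k
    · intro Y hY hg
      have hind := (indep_iff_of_point_eq hV Y).2 hg
      have := hind.encard_le_eRk_of_subset (Finset.coe_subset.2 hY)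
      rwa [hk, Set.encard_coe_eq_coe_finsetCard, Nat.cast_le] at this
    · intro e he
      obtain ⟨I, hI, heI⟩ := hF.exists_isBasis_notMem (Finset.mem_coe.2 he)
      lift I to Finset E using Set.toFinite I
      exact ⟨I, Finset.coe_subset.1 hI.subset, heI, hcard I hI,
        (indep_iff_of_point_eq hV I).1 hI.indep⟩
  · obtain ⟨I, hI⟩ := V.underlying.exists_isBasis (F : Set E) (Set.subset_univ _)
    lift I to Finset E using Set.toFinite I
    obtain ⟨g, hg, hgr⟩ := (indep_iff_of_point_eq hV I).1 hI.indep
    rw [← hcard I hI, ← Finset.card_attach]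
    refine Finset.card_le_card_of_injOn g (fun x _ => ?_) hg.injOn
    simp only [Finset.coe_filter, Set.mem_ofPred_eq, Finset.mem_univ, true_and]
    exact ⟨x, hI.subset x.2, hgr x⟩

/-! ### Coordinates of the contraction -/

/-- A basis of `J` in the underlying matroid. -/
noncomputable def restrictBase (V : ValuatedMatroid E) (J : Finset E) : Finset E :=
  J \ V.dual.contractBase Jᶜ

theorem restrictBase_isBasis (V : ValuatedMatroid E) (J : Finset E) :
    V.underlying.IsBasis (V.restrictBase J : Set E) (J : Set E) := by
  have h := V.dual.contractBase_isBase Jᶜ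
  rw [dual_underlying, Finset.coe_compl, Set.compl_eq_univ_sdiff, ← underlying_ground V] at h
  rw [restrictBase, Finset.coe_sdiff]
  exact Matroid.isBasis_sdiff_of_isBase_dual_contract (Set.subset_univ _) h

theorem contractBase_dual_compl_subset (V : ValuatedMatroid E) (J : Finset E) :
    V.dual.contractBase Jᶜ ⊆ J := fun x hx => by
  by_contra h
  exact Finset.disjoint_left.1 (V.dual.contractBase_disjoint Jᶜ) (Finset.mem_compl.2 h) hx

theorem rank_contract (V : ValuatedMatroid E) (J : Finset E) :
    (V.contract J).rank + (V.restrictBase J).card = V.rank := by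
  have h1 := V.rank_le
  have h2 : (V.dual.contractBase Jᶜ).card ≤ Fintype.card E - V.rank :=
    V.dual.contractBase_card_le Jᶜ
  have h3 : (V.restrictBase J).card + (V.dual.contractBase Jᶜ).card = J.card :=
    Finset.card_sdiff_add_card_eq_card (V.contractBase_dual_compl_subset J)
  have h4 := Finset.card_compl_add_card J
  change Fintype.card (Jᶜ : Finset E) - (Fintype.card E - V.rank -
    (V.dual.contractBase Jᶜ).card) + _ = _
  rw [Fintype.card_coe]
  -- This rules out truncation in the outer subtraction defining the rank of the contraction.
  have h5 : (V.restrictBase J).card ≤ V.rank := by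
    obtain ⟨B, hB, hIB⟩ := (V.restrictBase_isBasis J).indep.exists_isBase_superset
    obtain ⟨B, rfl, -⟩ := (V.underlying_isBase _).1 hB
    exact (Finset.card_le_card (Finset.coe_subset.1 hIB)).trans_eq B.2
  omega

/-- The set `B ∪ I`, where `I` is a basis of `J`, for a subset `B` of the complement of `J`. -/
noncomputable def contractSub (V : ValuatedMatroid E) (J : Finset E)
    (B : {B : Finset (Jᶜ : Finset E) // B.card = (V.contract J).rank}) :
    {B : Finset E // B.card = V.rank} :=
  V.complSub (V.dual.extendSub Jᶜ ((V.dual.restrict Jᶜ).complSub B))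

/-- Complementing within `Jᶜ`, adjoining the chosen basis `B_c ⊆ J`, and complementing in `E`
returns `B` together with `J \ B_c`. -/
theorem contractSub_val (V : ValuatedMatroid E) (J : Finset E)
    (B : {B : Finset (Jᶜ : Finset E) // B.card = (V.contract J).rank}) :
    (V.contractSub J B).1 =
      B.1.map (Function.Embedding.subtype (· ∈ Jᶜ)) ∪ V.restrictBase J := by
  ext x
  have hsub : x ∈ V.dual.contractBase Jᶜ → x ∈ J := fun h =>
    V.contractBase_dual_compl_subset J h
  change x ∈ (V.dual.extend Jᶜ B.1ᶜ)ᶜ ↔ _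
  rw [Finset.mem_compl, mem_extend, Finset.mem_union, restrictBase, Finset.mem_sdiff,
    Finset.mem_map]
  by_cases hx : x ∈ J
  · simp [hx]
  · simpa [hx] using fun _ h => hx (hsub h)

/-- Dual, restriction and dual are three successive pullbacks of coordinates, so an affine
representative can be followed through them. -/
theorem contract_point_eq {V : ValuatedMatroid E}
    {p : {B : Finset E // B.card = V.rank} → WithTop ℝ} {h : ∃ B, p B ≠ ⊤}
    (hV : TropProj.mk ⟨p, h⟩ = V.point) (J : Finset E) :
    ∃ h', (V.contract J).point = TropProj.mk ⟨fun B => p (V.contractSub J B), h'⟩ := by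
  obtain ⟨_, h₁⟩ := TropProj.comap_eq_mk hV V.complSub _
  obtain ⟨_, h₂⟩ := TropProj.comap_eq_mk h₁.symm (V.dual.extendSub Jᶜ) _
  exact TropProj.comap_eq_mk h₂.symm (V.dual.restrict Jᶜ).complSub _

end ValuatedMatroid

/-! ### Proof of the proposition -/

open Classical in
theorem proposition4p13 {E : Type*} [Fintype E] [DecidableEq E] (V : ValuatedMatroid E)
    (𝒜 : Multiset (TropProj E)) (h𝒜 : V.IsPresentation 𝒜)
    (F : Finset E) (hF : V.underlying.IsCyclicFlat (F : Set E))
    (k : ℕ) (hk : V.underlying.eRk (F : Set E) = k) :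
    Multiset.card (𝒜.filter fun x => x.IsInfOn F) + k = V.rank ∧
    (V.contract F).IsPresentation
      ((𝒜.filter fun x => x.IsInfOn F).pmap (TropProj.proj Fᶜ)
        (fun _ hx => TropProj.exists_compl_of_isInfOn (Multiset.mem_filter.1 hx).2)) := by
  obtain ⟨A, rfl, hA, hV⟩ := h𝒜
  set R : Finset (Fin V.rank) := Finset.univ.filter fun i => ∃ x ∈ F, (A i).1 x ≠ ⊤ with hRdef
  have hRk : R.card = k := by
    convert ValuatedMatroid.card_rows_meeting_cyclicFlat hV hF hk
  have hR : ∀ i ∉ R, ∀ x ∈ F, (A i).1 x = ⊤ := by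
    intro i hi x hx
    by_contra h
    exact hi (Finset.mem_filter.2 ⟨Finset.mem_univ _, x, hx, h⟩)
  have hI : (V.restrictBase F).card = R.card := by
    have := (V.restrictBase_isBasis F).encard_eq_eRk
    rwa [hk, Set.encard_coe_eq_coe_finsetCard, Nat.cast_inj, ← hRk] at this
  have hrank := V.rank_contract F
  have hcard : Fintype.card {i // i ∉ R} = (V.contract F).rank := by
    rw [Fintype.card_subtype_compl, Fintype.card_coe, Fintype.card_fin]
    omega
  let e : Fin (V.contract F).rank ≃ {i // i ∉ R} := (Fintype.equivFinOfCardEq hcard).symm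
  have hfilter : (Finset.univ.val.map fun i => TropProj.mk (A i)).filter (fun x => x.IsInfOn F) =
      (Finset.univ : Finset (Fin (V.contract F).rank)).val.map
        fun i => TropProj.mk (A (e i)) := by
    have h1 : (Finset.univ.filter fun i => (TropProj.mk (A i)).IsInfOn F) =
        Finset.univ.map (e.toEmbedding.trans (Function.Embedding.subtype _)) := by
      ext i
      simp only [Finset.mem_filter, Finset.mem_univ, true_and, Finset.mem_map]
      constructor
      · intro h
        have hi : i ∉ R := fun hi => by
          obtain ⟨x, hx, hfin⟩ := (Finset.mem_filter.1 hi).2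
          exact hfin (h x hx)
        exact ⟨e.symm ⟨i, hi⟩, by simp⟩
      · rintro ⟨j, rfl⟩
        exact hR _ (e j).2
    rw [Multiset.filter_map]
    have h2 := congrArg Finset.val h1
    rw [Finset.filter_val, Finset.map_val] at h2
    refine (congrArg (Multiset.map fun i => TropProj.mk (A i)) h2).trans ?_
    rw [Multiset.map_map]
    rfl
  refine ⟨?_, ?_⟩
  · rw [hfilter, Multiset.card_map, Finset.card_val, Finset.card_univ, Fintype.card_fin]
    omega
  have hfinite : ∀ i, ∃ b : (Fᶜ : Finset E), (A (e i)).1 b.1 ≠ ⊤ := by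
    intro i
    obtain ⟨x, hx⟩ := (A (e i)).2
    exact ⟨⟨x, Finset.mem_compl.2 fun h => hx (hR _ (e i).2 x h)⟩, hx⟩
  obtain ⟨h', hpoint⟩ := ValuatedMatroid.contract_point_eq hV F
  have hminor : ∀ B, _ := fun B => ValuatedMatroid.stiefelVec_union (fun i => (A i).1) hR e
    (I := V.restrictBase F) Finset.sdiff_subset hI B (V.contractSub F B) (V.contractSub_val F B)
  -- One finite coordinate of `V/F` shows both that the constant from the block `R × I` is finite
  -- and that the remaining rows have a finite minor.
  obtain ⟨B₀, hB₀⟩ := h'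
  have hB₁ := hB₀
  simp only [hminor] at hB₁
  obtain ⟨hc, hB₂⟩ := WithTop.add_ne_top.1 hB₁
  refine ⟨fun i => ⟨fun b => (A (e i)).1 b.1, hfinite i⟩, ?_, ⟨B₀, hB₂⟩, ?_⟩
  · have hpmap : ∀ {s t : Multiset (TropProj E)} (hst : s = t) (H : ∀ x ∈ s, _),
        s.pmap (TropProj.proj Fᶜ) H = t.pmap (TropProj.proj Fᶜ) (hst ▸ H) := by
      rintro s _ rfl H
      rfl
    rw [hpmap hfilter]
    exact (Multiset.pmap_map_eq_map _ _ _ _ _ fun _ _ => rfl).symm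
  · rw [hpoint]
    -- This real constant is the tropical scalar relating the two coordinate vectors.
    obtain ⟨c, hc⟩ := WithTop.ne_top_iff_exists.1 hc
    refine Quotient.sound ⟨c, fun B => ?_⟩
    change ValuatedMatroid.stiefelVec _ _ = _
    rw [hminor, ← hc, add_comm]
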